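/- All Banach spaces are real, and operators are bounded and linear. Let $Z$ be a separable Banach space and let $\varphi:\ell_1\to Z$ be a quotient map, i.e. a surjective operator. Then the following four conditions are equivalent: (i) every short exact sequence $0\to\ell_2\xrightarrow{j}Y\xrightarrow{\rho}Z\to0$ of Banach spaces and operators splits, i.e. there is an operator $R:Y\to\ell_2$ with $R\circ j=\mathrm{Id}_{\ell_2}$; (ii) $\operatorname{Ker}\varphi$ is a GT-space, i.e. every operator $T:\operatorname{Ker}\varphi\to\ell_2$ is $1$-summing: there is a constant $C$ such that $\sum_{i=1}^n\|Tx_i\|\le C\sup\{\sum_{i=1}^n|\xi(x_i)|:\xi\in(\operatorname{Ker}\varphi)^*,\ \|\xi\|\le1\}$ for all $n$ and all $x_1,\dots,x_n\in\operatorname{Ker}\varphi$; (iii) every nonnegative continuous quadratic form $q:\operatorname{Ker}\varphi\to\mathbb R$ extends to a nonnegative continuous quadratic form $Q:\ell_1\to\mathbb R$; (iv) every nonnegative continuous quadratic form $q:\operatorname{Ker}\varphi\to\mathbb R$ extends to a delta-semidefinite quadratic form $Q:\ell_1\to\mathbb R$, i.e. to a difference of two nonnegative continuous quadratic forms on $\ell_1$.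 Here a continuous quadratic form on a Banach space $X$ is a function $q:X\to\mathbb R$ of the form $q(x)=b(x,x)$ for some continuous bilinear form $b:X\times X\to\mathbb R$. -/

import Mathlib

open scoped ENNReal

universe u v

namespace GTSpace

/-- The real Banach space of absolutely summable sequences. -/
abbrev EllOne : Type := lp (fun _ : ℕ => ℝ) 1

/-- The real Hilbert space of square summable sequences. -/
abbrev EllTwo : Type := lp (fun _ : ℕ => ℝ) 2

section Summing

variable {X : Type*} [NormedAddCommGroup X] [NormedSpace ℝ X]
  {Y : Type*} [NormedAddCommGroup Y] [NormedSpace ℝ Y]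

/-- The weak `ℓ₁`-norm of a finite family: the supremum of `∑ i, |ξ (x i)|` over all `ξ` in the
closed unit ball of the dual. -/
noncomputable def weakSum {n : ℕ} (x : Fin n → X) : ℝ :=
  ⨆ ξ : Metric.closedBall (0 : StrongDual ℝ X) 1, ∑ i, |ξ.1 (x i)|

/-- The supremum defining `weakSum` is over a bounded set. -/
theorem bddAbove_weakSum {n : ℕ} (x : Fin n → X) :
    BddAbove (Set.range fun ξ : Metric.closedBall (0 : StrongDual ℝ X) 1 =>
      ∑ i, |ξ.1 (x i)|) := by
  refine ⟨∑ i, ‖x i‖, ?_⟩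
  rintro _ ⟨ξ, rfl⟩
  refine Finset.sum_le_sum fun i _ => ?_
  exact ξ.1.le_of_opNorm_le_of_le (mem_closedBall_zero_iff.mp ξ.2) le_rfl |>.trans_eq (one_mul _)

/-- A bounded operator is `1`-summing (absolutely summing). -/
def IsOneSumming (T : X →L[ℝ] Y) : Prop :=
  ∃ C : ℝ, ∀ (n : ℕ) (x : Fin n → X), ∑ i, ‖T (x i)‖ ≤ C * weakSum x

variable (X) in
/-- `X` is a GT-space: every bounded operator from `X` to `ℓ₂` is `1`-summing. -/
def IsGTSpace : Prop :=
  ∀ T : X →L[ℝ] EllTwo, IsOneSumming T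

end Summing

section Exact

variable {X : Type*} [NormedAddCommGroup X] [NormedSpace ℝ X]
  {Y : Type*} [NormedAddCommGroup Y] [NormedSpace ℝ Y]
  {Z : Type*} [NormedAddCommGroup Z] [NormedSpace ℝ Z]

/-- `0 → X → Y → Z → 0` is exact, with bounded operators `j` and `ρ`. -/
structure IsShortExact (j : X →L[ℝ] Y) (ρ : Y →L[ℝ] Z) : Prop where
  injective : Function.Injective j
  exact : Function.Exact j ρ
  surjective : Function.Surjective ρ

/-- A short exact sequence beginning with `j` splits: `j` has a bounded linear retraction. -/
def Splits (j : X →L[ℝ] Y) : Prop :=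
  ∃ R : Y →L[ℝ] X, R.comp j = ContinuousLinearMap.id ℝ X

end Exact

/-- Every short exact sequence `0 → ℓ₂ → Y → Z → 0` of Banach spaces splits. The middle spaces
range over an arbitrary universe `v`. -/
def EveryTwistedSumSplits (Z : Type u) [NormedAddCommGroup Z] [NormedSpace ℝ Z] : Prop :=
  ∀ (Y : Type v) [NormedAddCommGroup Y] [NormedSpace ℝ Y] [CompleteSpace Y]
    (j : EllTwo →L[ℝ] Y) (ρ : Y →L[ℝ] Z), IsShortExact j ρ → Splits j

section Quadratic

variable {X : Type*} [NormedAddCommGroup X] [NormedSpace ℝ X]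

/-- Continuous quadratic forms: `q x = b x x` with `b` a continuous bilinear form. -/
def IsQuadForm (q : X → ℝ) : Prop :=
  ∃ b : X →L[ℝ] X →L[ℝ] ℝ, ∀ x, q x = b x x

/-- Nonnegative continuous quadratic forms. -/
def IsNonnegQuadForm (q : X → ℝ) : Prop :=
  IsQuadForm q ∧ ∀ x, 0 ≤ q x

/-- Delta-semidefinite forms: differences of two nonnegative continuous quadratic forms. -/
def IsDeltaSemidefinite (q : X → ℝ) : Prop :=
  ∃ q₁ q₂ : X → ℝ, IsNonnegQuadForm q₁ ∧ IsNonnegQuadForm q₂ ∧ ∀ x, q x = q₁ x - q₂ x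

end Quadratic

end GTSpace

/-! Each condition amounts to every operator `T : Ker φ → ℓ₂` extending to `ℓ₁`. A nonnegative form
on a separable space is `‖A x‖ ^ 2` with `A` into `ℓ₂`. If `‖T x‖ ≤ ‖A x‖` on `Ker φ`, then `T`
factors through the closure of `A (Ker φ)`, and orthogonal projection extends it. So domination of
`‖T x‖ ^ 2` by a nonnegative form on `ℓ₁` suffices (`IsNonnegQuadForm.exists_extension`); a
delta-semidefinite extension `q₁ - q₂` supplies the dominating form `q₁`.

Splitting: the pushout of `Ker φ → ℓ₁` along `T` is a twisted sum, and its retraction yields the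
extension. Conversely, `ℓ₁` is projective, so `φ` lifts through `ρ`; correcting the lift by an
extension of its restriction to `Ker φ` gives a section of `ρ`.

GT: an extendable `T` is `1`-summing by Grothendieck's theorem (`isOneSumming_restrict`); a
`1`-summing `T` is dominated by a form on `ℓ₁` by a Pietsch-type separation argument
(`IsOneSumming.exists_quadForm_domination`). -/

namespace GTSpace

/-! ### Quadratic forms and Hilbert-valued operators -/

/-- A positive semidefinite symmetric form is realised by a linear map with dense range into a
Hilbert space. -/
theorem exists_hilbert_realization {V : Type u} [AddCommGroup V] [Module ℝ V]
    (c : PreInnerProductSpace.Core ℝ V) :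
    ∃ (H : Type u) (_ : NormedAddCommGroup H) (_ : InnerProductSpace ℝ H) (_ : CompleteSpace H)
      (A : V →ₗ[ℝ] H), DenseRange A ∧ ∀ x, ‖A x‖ ^ 2 = c.inner x x := by
  let : SeminormedAddCommGroup V := @InnerProductSpace.Core.toSeminormedAddCommGroup ℝ V _ _ _ c
  let : InnerProductSpace ℝ V := InnerProductSpace.ofCore c
  refine ⟨UniformSpace.Completion V, inferInstance, inferInstance, inferInstance,
    (UniformSpace.Completion.toComplL (𝕜 := ℝ) (E := V)).toLinearMap, ?_, fun x => ?_⟩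
  · exact UniformSpace.Completion.denseRange_coe
  · have h : ‖(UniformSpace.Completion.toComplL (𝕜 := ℝ) (E := V)).toLinearMap x‖ = ‖x‖ :=
      UniformSpace.Completion.norm_coe x
    rw [h, ← real_inner_self_eq_norm_sq]

/-- An orthonormal family in a separable space is countable. -/
theorem countable_of_orthonormal {H ι : Type*} [NormedAddCommGroup H] [InnerProductSpace ℝ H]
    [TopologicalSpace.SeparableSpace H] {w : ι → H} (hw : Orthonormal ℝ w) : Countable ι := by
  have h : (Set.univ : Set ι).Countable := by
    refine Set.PairwiseDisjoint.countable_of_isOpen (s := fun i => Metric.ball (w i) (1 / 2)) ?_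
      (fun _ _ => Metric.isOpen_ball) (fun i _ => ⟨w i, by simp⟩)
    intro i _ j _ hij
    refine Metric.ball_disjoint_ball ?_
    have h2 : ‖w i - w j‖ ^ 2 = 2 := by
      rw [norm_sub_sq_real, hw.1 i, hw.1 j, hw.2 hij]; norm_num
    rw [dist_eq_norm]
    nlinarith [norm_nonneg (w i - w j)]
  exact Set.countable_univ_iff.mp h

/-- A separable Hilbert space embeds isometrically in `ℓ₂`. -/
theorem exists_linearIsometry_ellTwo (H : Type*) [NormedAddCommGroup H] [InnerProductSpace ℝ H]
    [CompleteSpace H] [TopologicalSpace.SeparableSpace H] : Nonempty (H →ₗᵢ[ℝ] EllTwo) := by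
  obtain ⟨w, b, -⟩ := exists_hilbertBasis ℝ H
  have : Countable w := countable_of_orthonormal b.orthonormal
  obtain ⟨f, hf⟩ := exists_injective_nat w
  let e : ℕ → EllTwo := fun n => lp.single 2 n 1
  have he : Orthonormal ℝ e := by
    classical
    rw [orthonormal_iff_ite]
    intro i j
    simp [e, lp.inner_single_left, Pi.single_apply]
  exact ⟨((he.comp f hf).orthogonalFamily.linearIsometry).comp b.repr.toLinearIsometry⟩

/-- A nonnegative continuous quadratic form on a separable space is `x ↦ ‖A x‖ ^ 2` for some
operator `A` into `ℓ₂`. -/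
theorem IsNonnegQuadForm.exists_operator {X : Type*} [NormedAddCommGroup X] [NormedSpace ℝ X]
    [TopologicalSpace.SeparableSpace X] {q : X → ℝ} (hq : IsNonnegQuadForm q) :
    ∃ A : X →L[ℝ] EllTwo, ∀ x, q x = ‖A x‖ ^ 2 := by
  obtain ⟨⟨b, hb⟩, h0⟩ := hq
  -- `b` need not be symmetric; its symmetrisation has the same diagonal.
  let c : PreInnerProductSpace.Core ℝ X :=
    { inner := fun x y => (b x y + b y x) / 2
      conj_inner_symm := fun x y => by simp [add_comm]
      re_inner_nonneg := fun x => by simpa [← hb] using h0 x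
      add_left := fun x y z => by simp; ring
      smul_left := fun x y r => by simp; ring }
  obtain ⟨H, _, _, _, A, hA, hAq⟩ := exists_hilbert_realization c
  have hAq' : ∀ x, q x = ‖A x‖ ^ 2 := fun x => by
    rw [hAq, hb]; change _ = (b x x + b x x) / 2; ring
  let A' : X →L[ℝ] H := A.mkContinuous (Real.sqrt ‖b‖) fun x => by
    refine le_of_sq_le_sq ?_ (by positivity)
    rw [← hAq', mul_pow, Real.sq_sqrt (by positivity), hb]
    refine (le_abs_self _).trans ((b.le_opNorm₂ x x).trans_eq (by ring))
  have : TopologicalSpace.SeparableSpace H := DenseRange.separableSpace (f := A') hA A'.continuous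
  obtain ⟨U⟩ := exists_linearIsometry_ellTwo H
  exact ⟨U.toContinuousLinearMap.comp A', fun x => by simp [A', hAq']⟩

theorem isNonnegQuadForm_norm_sq {X H : Type*} [NormedAddCommGroup X] [NormedSpace ℝ X]
    [NormedAddCommGroup H] [InnerProductSpace ℝ H] (A : X →L[ℝ] H) :
    IsNonnegQuadForm fun x => ‖A x‖ ^ 2 :=
  ⟨⟨(innerSL ℝ).bilinearComp A A, fun x => by simp⟩, fun x => by positivity⟩

/-- An operator on a subspace that is dominated by the restriction of an operator into a Hilbert
space extends to the whole space. -/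
theorem exists_extension_of_norm_le {X H Y : Type*} [NormedAddCommGroup X] [NormedSpace ℝ X]
    [NormedAddCommGroup H] [InnerProductSpace ℝ H] [CompleteSpace H]
    [NormedAddCommGroup Y] [NormedSpace ℝ Y] [CompleteSpace Y]
    {K : Submodule ℝ X} (T : K →L[ℝ] Y) (A : X →L[ℝ] H) (h : ∀ x : K, ‖T x‖ ≤ ‖A x‖) :
    ∃ S : X →L[ℝ] Y, ∀ x : K, S x = T x := by
  let A₀ : K →ₗ[ℝ] H := A.toLinearMap ∘ₗ K.subtype
  let M : Submodule ℝ H := (LinearMap.range A₀).topologicalClosure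
  have hM : ∀ x : K, A x ∈ M := fun x => Submodule.le_topologicalClosure _ ⟨x, rfl⟩
  let A₁ : K →ₗ[ℝ] M := A₀.codRestrict M hM
  have hd : DenseRange A₁ := by
    rw [DenseRange, Subtype.dense_iff]
    intro y hy
    refine closure_mono ?_ hy
    rintro _ ⟨x, rfl⟩
    exact ⟨A₁ x, ⟨x, rfl⟩, rfl⟩
  have : CompleteSpace M := (Submodule.isClosed_topologicalClosure _).completeSpace_coe
  refine ⟨(T.toLinearMap.extendOfNorm A₁).comp (M.orthogonalProjectionOnto.comp A), fun x => ?_⟩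
  have h1 : M.orthogonalProjectionOnto (A x) = A₁ x :=
    Submodule.orthogonalProjectionOnto_mem_subspace_eq_self (A₁ x)
  simp only [ContinuousLinearMap.comp_apply, h1]
  exact LinearMap.extendOfNorm_eq hd ⟨1, fun x => (h x).trans_eq (one_mul ‖A x‖).symm⟩ x

/-! ### Operators on `ℓ₁` -/

theorem hasSum_single_ellOne (x : EllOne) : HasSum (fun n => x n • lp.single 1 n (1 : ℝ)) x := by
  have := lp.hasSum_single (p := 1) (by simp) x
  convert this using 2 with n
  rw [← lp.single_smul, smul_eq_mul, mul_one]

instance : TopologicalSpace.SeparableSpace EllOne := by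
  have h : TopologicalSpace.IsSeparable
      (closure (Submodule.span ℝ (Set.range fun n : ℕ => (lp.single 1 n (1 : ℝ) : EllOne)) :
        Set EllOne)) :=
    (Set.countable_range _).isSeparable.span.closure
  rw [← TopologicalSpace.isSeparable_univ_iff]
  refine h.mono fun x _ => ?_
  refine mem_closure_of_tendsto (hasSum_single_ellOne x) (Filter.Eventually.of_forall fun s => ?_)
  exact Submodule.sum_mem _ fun n _ =>
    Submodule.smul_mem _ _ (Submodule.subset_span ⟨n, rfl⟩)

theorem hasSum_norm_ellOne (x : EllOne) : HasSum (fun n => ‖x n‖) ‖x‖ := by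
  have := lp.hasSum_norm (p := 1) (by simp) x
  simpa using this

/-- A bounded sequence in a Banach space is the image of the unit vector basis under an operator
on `ℓ₁`. -/
theorem exists_operator_ellOne {Y : Type*} [NormedAddCommGroup Y] [NormedSpace ℝ Y]
    [CompleteSpace Y] (y : ℕ → Y) {C : ℝ} (hy : ∀ n, ‖y n‖ ≤ C) :
    ∃ S : EllOne →L[ℝ] Y, ∀ n, S (lp.single 1 n 1) = y n := by
  have hle : ∀ (x : EllOne) n, ‖x n • y n‖ ≤ ‖x n‖ * C := fun x n => by
    rw [norm_smul]; gcongr; exact hy n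
  have hC : ∀ x : EllOne, HasSum (fun n => ‖x n‖ * C) (‖x‖ * C) := fun x =>
    (hasSum_norm_ellOne x).mul_right C
  have hs : ∀ x : EllOne, Summable fun n => x n • y n := fun x =>
    Summable.of_norm_bounded (hC x).summable (hle x)
  let S : EllOne →ₗ[ℝ] Y :=
    { toFun := fun x => ∑' n, x n • y n
      map_add' := fun x z => by
        rw [← (hs x).tsum_add (hs z)]
        simp [add_smul]
      map_smul' := fun c x => by
        rw [RingHom.id_apply, ← (hs x).tsum_const_smul]
        simp [mul_smul] }
  refine ⟨S.mkContinuous C fun x => ?_, fun n => ?_⟩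
  · rw [mul_comm]
    exact tsum_of_norm_bounded (hC x) (hle x)
  · change ∑' m, (lp.single 1 n (1 : ℝ) : EllOne) m • y m = y n
    rw [tsum_eq_single n]
    · simp
    · intro m hm
      simp [hm]

theorem ext_operator_ellOne {Y : Type*} [NormedAddCommGroup Y] [NormedSpace ℝ Y]
    {S T : EllOne →L[ℝ] Y} (h : ∀ n, S (lp.single 1 n 1) = T (lp.single 1 n 1)) : S = T := by
  ext x
  have h1 := (hasSum_single_ellOne x).mapL S
  have h2 := (hasSum_single_ellOne x).mapL T
  simp only [map_smul, h] at h1 h2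
  exact h1.unique h2

/-- `ℓ₁` is projective. -/
theorem exists_lift_ellOne {Y Z : Type*} [NormedAddCommGroup Y] [NormedSpace ℝ Y]
    [CompleteSpace Y] [NormedAddCommGroup Z] [NormedSpace ℝ Z] [CompleteSpace Z]
    (φ : EllOne →L[ℝ] Z) {ρ : Y →L[ℝ] Z} (hρ : Function.Surjective ρ) :
    ∃ S : EllOne →L[ℝ] Y, ρ.comp S = φ := by
  obtain ⟨C, hC, h⟩ := ρ.exists_preimage_norm_le hρ
  choose g hg hgn using h
  obtain ⟨S, hS⟩ := exists_operator_ellOne (fun n => g (φ (lp.single 1 n 1)))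
    (C := C * ‖φ‖) fun n => (hgn _).trans <| by
      gcongr
      refine (φ.le_opNorm _).trans_eq ?_
      rw [lp.norm_single (by simp)]
      simp
  exact ⟨S, ext_operator_ellOne fun n => by simp [hS, hg]⟩

/-! ### Twisted sums and extension of operators -/

section TwistedSum

variable {Z : Type u} [NormedAddCommGroup Z] [NormedSpace ℝ Z]

/-- If operators from `Ker φ` to `ℓ₂` extend to `ℓ₁`, then twisted sums of `ℓ₂` and `Z` split. -/
theorem everyTwistedSumSplits_of_extension [CompleteSpace Z] {φ : EllOne →L[ℝ] Z}
    (hφ : Function.Surjective φ)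
    (hext : ∀ T : φ.ker →L[ℝ] EllTwo, ∃ S : EllOne →L[ℝ] EllTwo, ∀ x : φ.ker, S x = T x) :
    EveryTwistedSumSplits.{u, v} Z := by
  intro Y _ _ _ j ρ hex
  obtain ⟨P, hP⟩ := exists_lift_ellOne φ hex.surjective
  have hP' : ∀ x, ρ (P x) = φ x := fun x => by rw [← hP]; rfl
  have hrange : Set.range j = (ρ.ker : Set Y) := by
    ext y; exact (hex.exact y).symm
  have hcl : IsClosed (Set.range j) := by
    rw [hrange]; exact ρ.isClosed_ker
  let e := j.equivRange hex.injective hcl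
  have he : ∀ y, j (e.symm y) = y := fun y => congrArg Subtype.val (e.apply_symm_apply y)
  have hmem : ∀ x : φ.ker, P x ∈ j.range := fun x => by
    have : P x ∈ Set.range j := by
      rw [hrange]
      change ρ (P x) = 0
      rw [hP']; exact x.2
    exact this
  let T : φ.ker →L[ℝ] EllTwo :=
    e.symm.toContinuousLinearMap.comp ((P.comp φ.ker.subtypeL).codRestrict j.range hmem)
  have hT : ∀ x : φ.ker, j (T x) = P x := fun x => he _
  obtain ⟨S, hS⟩ := hext T
  have hD : ∀ x ∈ φ.ker, (P - j.comp S) x = 0 := fun x hx => by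
    have := hT ⟨x, hx⟩
    rw [← hS] at this
    simp [this]
  obtain ⟨C, hC, hg⟩ := φ.exists_preimage_norm_le hφ
  choose g hg hgn using hg
  -- `g` need not be linear, but `P - j ∘ S` kills `Ker φ`, so its value at `g z` depends only on
  -- `z`.
  have hDg : ∀ x z, φ x = z → (P - j.comp S) (g z) = (P - j.comp S) x := fun x z hxz => by
    rw [← sub_eq_zero, ← map_sub]
    refine hD _ ?_
    change φ (g z - x) = 0
    rw [map_sub, hg, hxz, sub_self]
  let σ : Z →ₗ[ℝ] Y :=
    { toFun := fun z => (P - j.comp S) (g z)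
      map_add' := fun z w => by
        rw [hDg (g z + g w) _ (by rw [map_add, hg, hg]), map_add]
      map_smul' := fun c z => by
        rw [hDg (c • g z) _ (by rw [map_smul, hg]), map_smul]; rfl }
  let σ' : Z →L[ℝ] Y := σ.mkContinuous (‖P - j.comp S‖ * C) fun z => by
    refine ((P - j.comp S).le_opNorm _).trans ?_
    rw [mul_assoc]
    gcongr
    exact hgn z
  have hjρ : ∀ a, ρ (j a) = 0 := fun a => (hex.exact _).2 ⟨a, rfl⟩
  have hσ : ∀ z, ρ (σ' z) = z := fun z => by
    change ρ ((P - j.comp S) (g z)) = z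
    simp [hP', hg, hjρ]
  have hmem' : ∀ y, (ContinuousLinearMap.id ℝ Y - σ'.comp ρ) y ∈ j.range := fun y => by
    have : (ContinuousLinearMap.id ℝ Y - σ'.comp ρ) y ∈ Set.range j := by
      rw [hrange]
      change ρ _ = 0
      simp [hσ]
    exact this
  refine ⟨e.symm.toContinuousLinearMap.comp
    ((ContinuousLinearMap.id ℝ Y - σ'.comp ρ).codRestrict j.range hmem'), ?_⟩
  ext1 a
  apply hex.injective
  refine (he _).trans ?_
  simp [hjρ]

/-- If twisted sums of `ℓ₂` and `Z` split, then operators from `Ker φ` to `ℓ₂` extend to `ℓ₁`. -/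
theorem EveryTwistedSumSplits.extension (h : EveryTwistedSumSplits.{u, v} Z)
    {φ : EllOne →L[ℝ] Z} (hφ : Function.Surjective φ) (T : φ.ker →L[ℝ] EllTwo) :
    ∃ S : EllOne →L[ℝ] EllTwo, ∀ x : φ.ker, S x = T x := by
  -- Pushout: dividing by the pairs `(T x, -x)` identifies `x` with `T x`.
  let N : Submodule ℝ (EllTwo × EllOne) :=
    LinearMap.range (T.prod (-φ.ker.subtypeL)).toLinearMap
  have hN : ∀ p : EllTwo × EllOne, p ∈ N ↔ ∃ x : φ.ker, T x = p.1 ∧ -(x : EllOne) = p.2 := by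
    rintro ⟨a, b⟩
    constructor
    · rintro ⟨x, hx⟩
      exact ⟨x, congrArg Prod.fst hx, congrArg Prod.snd hx⟩
    · rintro ⟨x, h1, h2⟩
      exact ⟨x, Prod.ext h1 h2⟩
  -- The second coordinate determines `x`, so limits stay in `N` because `T` is continuous and `Ker
  -- φ` is closed.
  have hcl : IsClosed (N : Set (EllTwo × EllOne)) := by
    have hker : IsClosed {p : EllTwo × EllOne | -p.2 ∈ φ.ker} :=
      φ.isClosed_ker.preimage (by fun_prop)
    rw [← isSeqClosed_iff_isClosed]
    intro s p hs hsp
    choose x hx1 hx2 using fun n => (hN _).1 (hs n)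
    have hp : -p.2 ∈ φ.ker := hker.mem_of_tendsto hsp (Filter.Eventually.of_forall fun n => by
      change -(s n).2 ∈ φ.ker
      rw [← hx2 n, neg_neg]; exact (x n).2)
    refine (hN p).2 ⟨⟨-p.2, hp⟩, ?_, by simp⟩
    have hx : Filter.Tendsto x Filter.atTop (nhds ⟨-p.2, hp⟩) := by
      rw [tendsto_subtype_rng]
      have : (fun n => (x n : EllOne)) = fun n => -(s n).2 := by
        funext n; rw [← hx2 n, neg_neg]
      rw [this]
      exact ((continuous_snd.tendsto p).comp hsp).neg
    refine tendsto_nhds_unique ((T.continuous.tendsto _).comp hx) ?_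
    have : T ∘ x = fun n => (s n).1 := by
      funext n; exact hx1 n
    rw [this]
    exact (continuous_fst.tendsto p).comp hsp
  let Y := (EllTwo × EllOne) ⧸ N
  let π : EllTwo × EllOne →L[ℝ] Y :=
    N.mkQ.mkContinuous 1 fun p => by simpa using! Submodule.Quotient.norm_mk_le N p
  have hπ : ∀ p, π p = 0 ↔ p ∈ N := fun p => Submodule.Quotient.mk_eq_zero N
  -- The quotient lives in `Type`; the hypothesis speaks of `Type v`.
  let up : Y ≃L[ℝ] ULift.{v} Y := ContinuousLinearEquiv.ulift.symm
  let j : EllTwo →L[ℝ] ULift.{v} Y :=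
    up.toContinuousLinearMap.comp (π.comp (ContinuousLinearMap.inl ℝ _ _))
  let ρ₀ : Y →ₗ[ℝ] Z := N.liftQ (φ.comp (ContinuousLinearMap.snd ℝ _ _)).toLinearMap <| by
    rintro p hp
    obtain ⟨x, -, hx⟩ := (hN p).1 hp
    change φ p.2 = 0
    rw [← hx, map_neg, neg_eq_zero]; exact x.2
  have hρ₀ : ∀ p, ρ₀ (π p) = φ p.2 := fun p => rfl
  have hπs : Function.Surjective π := N.mkQ_surjective
  let ρ₁ : Y →L[ℝ] Z := ⟨ρ₀, by
    have : Continuous fun p => ρ₀ (N.mkQ p) := φ.continuous.comp continuous_snd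
    exact continuous_quot_lift _ this⟩
  let ρ : ULift.{v} Y →L[ℝ] Z := ρ₁.comp up.symm.toContinuousLinearMap
  have hex : IsShortExact j ρ := by
    refine ⟨?_, ?_, ?_⟩
    · rw [injective_iff_map_eq_zero]
      intro a ha
      have : π (a, 0) = 0 := up.injective (ha.trans (map_zero up).symm)
      obtain ⟨x, hx1, hx2⟩ := (hN _).1 ((hπ _).1 this)
      have : x = 0 := Subtype.ext (neg_eq_zero.1 hx2)
      rw [← show T x = a from hx1, this, map_zero]
    · intro y
      obtain ⟨y, rfl⟩ := up.surjective y
      obtain ⟨⟨a, b⟩, rfl⟩ := hπs y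
      have hρ : ρ (up (π (a, b))) = φ b := rfl
      rw [hρ]
      constructor
      · intro hb
        refine ⟨a + T ⟨b, hb⟩, congrArg up ?_⟩
        change π (a + T ⟨b, hb⟩, 0) = _
        rw [← sub_eq_zero, ← map_sub, hπ, hN]
        exact ⟨⟨b, hb⟩, by simp, by simp⟩
      · rintro ⟨c, hc⟩
        have : π (c, 0) = π (a, b) := up.injective hc
        rw [← hρ₀ (a, b), ← this, hρ₀, map_zero]
    · intro z
      obtain ⟨x, rfl⟩ := hφ z
      exact ⟨up (π (0, x)), rfl⟩
  obtain ⟨R, hR⟩ := h (ULift.{v} Y) j ρ hex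
  refine ⟨R.comp (up.toContinuousLinearMap.comp (π.comp (ContinuousLinearMap.inr ℝ _ _))),
    fun x => ?_⟩
  have h1 : π (0, (x : EllOne)) = π (T x, 0) := by
    rw [eq_comm, ← sub_eq_zero, ← map_sub, hπ, hN]
    exact ⟨x, by simp, by simp⟩
  change R (up (π (0, (x : EllOne)))) = T x
  rw [h1]
  exact congrArg (fun f : EllTwo →L[ℝ] EllTwo => f (T x)) hR

end TwistedSum

/-! ### Pietsch-type domination -/

/-- A convex cone of bounded functions that contains the nonnegative ones and has no uniformly
negative element is nonnegative under some normalised functional. -/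
theorem exists_functional_nonneg {ι : Type*} [Nonempty ι]
    {A : Set (lp (fun _ : ι => ℝ) ∞)}
    (hadd : ∀ f ∈ A, ∀ g ∈ A, f + g ∈ A) (hsmul : ∀ f ∈ A, ∀ t : ℝ, 0 ≤ t → t • f ∈ A)
    (hA0 : ∀ f : lp (fun _ : ι => ℝ) ∞, (∀ i, 0 ≤ f i) → f ∈ A)
    (hneg : ∀ f ∈ A, ∀ ε > 0, ∃ i, -ε < f i) :
    ∃ Λ : StrongDual ℝ (lp (fun _ : ι => ℝ) ∞), Λ 1 = 1 ∧ ∀ f ∈ A, 0 ≤ Λ f := by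
  have hconv : Convex ℝ A := fun f hf g hg a b ha hb _ =>
    hadd _ (hsmul f hf a ha) _ (hsmul g hg b hb)
  -- Every `f` in this ball is at most `-(1 - ‖f + 1‖) < 0` everywhere.
  have hdisj : Disjoint (Metric.ball (-1 : lp (fun _ : ι => ℝ) ∞) 1) A := by
    rw [Set.disjoint_left]
    intro f hf hfA
    rw [Metric.mem_ball, dist_eq_norm, sub_neg_eq_add] at hf
    obtain ⟨i, hi⟩ := hneg f hfA (1 - ‖f + 1‖) (by linarith)
    have h1 := lp.norm_apply_le_norm ENNReal.top_ne_zero (f + 1) i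
    have h2 : (f + 1) i = f i + 1 := rfl
    rw [h2, Real.norm_eq_abs] at h1
    linarith [le_abs_self (f i + 1)]
  obtain ⟨Λ, s, hlt, hge⟩ :=
    geometric_hahn_banach_open (convex_ball _ _) Metric.isOpen_ball hconv hdisj
  have hs : s ≤ 0 := by simpa using hge 0 (hA0 0 fun i => le_rfl)
  have h1 : 0 < Λ 1 := by
    have := hlt (-1) (Metric.mem_ball_self one_pos)
    rw [map_neg] at this
    linarith
  -- A negative value could be scaled below the separating level `s`.
  have hpos : ∀ f ∈ A, 0 ≤ Λ f := by
    intro f hf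
    by_contra! hneg'
    obtain ⟨n, hn⟩ := exists_nat_gt (s / Λ f)
    have := hge _ (hsmul f hf n n.cast_nonneg)
    rw [map_smul, smul_eq_mul] at this
    rw [div_lt_iff_of_neg hneg'] at hn
    linarith
  refine ⟨(Λ 1)⁻¹ • Λ, ?_, fun f hf => ?_⟩
  · simp [h1.ne']
  · have := hpos f hf
    change 0 ≤ (Λ 1)⁻¹ * Λ f
    positivity

/-- A `1`-summing operator on a subspace of `X` is dominated by a nonnegative continuous quadratic
form on `X`. -/
theorem IsOneSumming.exists_quadForm_domination {X Y : Type*} [NormedAddCommGroup X]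
    [NormedSpace ℝ X] [NormedAddCommGroup Y] [NormedSpace ℝ Y] {K : Submodule ℝ X}
    {T : K →L[ℝ] Y} (hT : IsOneSumming T) :
    ∃ Q : X → ℝ, IsNonnegQuadForm Q ∧ ∀ x : K, ‖T x‖ ^ 2 ≤ Q x := by
  obtain ⟨C₀, hC₀⟩ := hT
  let ι : Type _ := Metric.closedBall (0 : StrongDual ℝ K) 1
  have hι : Nonempty ι := ⟨⟨0, Metric.mem_closedBall_self zero_le_one⟩⟩
  have hw0 : ∀ (n : ℕ) (x : Fin n → K), 0 ≤ weakSum x := fun n x =>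
    Real.iSup_nonneg fun ξ => Finset.sum_nonneg fun i _ => abs_nonneg _
  obtain ⟨C, hC0, hC⟩ : ∃ C : ℝ, 0 ≤ C ∧
      ∀ (n : ℕ) (x : Fin n → K), ∑ i, ‖T (x i)‖ ≤ C * weakSum x :=
    ⟨max C₀ 0, le_max_right _ _, fun n x => (hC₀ n x).trans <|
      mul_le_mul_of_nonneg_right (le_max_left _ _) (hw0 n x)⟩
  -- Norm-preserving extensions make the evaluation map `J`, and hence the dominating form,
  -- available on all of `X`.
  choose η hη hηn using fun ξ : ι => exists_extension_norm_eq K ξ.1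
  have hηx : ∀ (ξ : ι) x, ‖η ξ x‖ ≤ ‖x‖ := fun ξ x => by
    refine ((η ξ).le_of_opNorm_le ?_ x).trans_eq (one_mul _)
    rw [hηn]
    have h : dist ξ.1 0 ≤ 1 := ξ.2
    exact (dist_zero_right ξ.1).symm.trans_le h
  let E := lp (fun _ : ι => ℝ) ∞
  let J₀ : X →ₗ[ℝ] E :=
    { toFun := fun x => ⟨fun ξ => η ξ x, memℓp_infty ⟨‖x‖, by rintro _ ⟨ξ, rfl⟩; exact hηx ξ x⟩⟩
      map_add' := fun x y => by ext ξ; exact map_add (η ξ) x y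
      map_smul' := fun c x => by ext ξ; exact map_smul (η ξ) c x }
  let J : X →L[ℝ] E := J₀.mkContinuous 1 fun x => by
    rw [one_mul]
    exact lp.norm_le_of_forall_le (norm_nonneg x) fun ξ => hηx ξ x
  -- Summability of `T` says exactly that these lower bounds are never uniformly negative; `Λ` then
  -- acts as a mean over the dual ball.
  let A : Set E := {f | ∃ (n : ℕ) (x : Fin n → K),
    ∀ ξ : ι, C * ∑ i, |ξ.1 (x i)| - ∑ i, ‖T (x i)‖ ≤ f ξ}
  obtain ⟨Λ, hΛ1, hΛ⟩ := exists_functional_nonneg (A := A) (by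
      rintro f ⟨n, x, hx⟩ g ⟨m, y, hy⟩
      refine ⟨n + m, Fin.append x y, fun ξ => ?_⟩
      have : (f + g) ξ = f ξ + g ξ := rfl
      simp only [Fin.sum_univ_add, Fin.append_left, Fin.append_right, this]
      linarith [hx ξ, hy ξ])
    (by
      rintro f ⟨n, x, hx⟩ t ht
      refine ⟨n, fun i => t • x i, fun ξ => ?_⟩
      have : (t • f) ξ = t * f ξ := rfl
      simp only [map_smul, smul_eq_mul, abs_mul, norm_smul, Real.norm_eq_abs, abs_of_nonneg ht,
        ← Finset.mul_sum, this]
      have := mul_le_mul_of_nonneg_left (hx ξ) ht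
      linarith)
    (fun f hf => ⟨0, 0, fun ξ => by simpa using hf ξ⟩)
    (by
      rintro f ⟨n, x, hx⟩ ε hε
      by_contra! hcon
      have h1 : C * weakSum x ≤ ∑ i, ‖T (x i)‖ - ε := by
        rw [weakSum, Real.mul_iSup_of_nonneg hC0]
        exact ciSup_le fun ξ => by linarith [hx ξ, hcon ξ]
      linarith [hC n x])
  have hsq : ∀ x ξ, (J x * J x) ξ = η ξ x * η ξ x := fun x ξ => rfl
  let b : X →L[ℝ] X →L[ℝ] ℝ :=
    (C ^ 2) • ((ContinuousLinearMap.compL ℝ E E ℝ Λ).comp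
      (ContinuousLinearMap.mul ℝ E)).bilinearComp J J
  have hb : ∀ x, b x x = C ^ 2 * Λ (J x * J x) := fun x => rfl
  refine ⟨fun x => b x x, ⟨⟨b, fun x => rfl⟩, fun x => ?_⟩, fun x => ?_⟩
  · refine mul_nonneg (sq_nonneg C) (hΛ _ ⟨0, 0, fun ξ => ?_⟩)
    simpa [hsq] using mul_self_nonneg _
  · have hmem : (C ^ 2) • (J x * J x) - (‖T x‖ ^ 2) • (1 : E) ∈ A := by
      -- With `s = C * |ξ x|` and `r = ‖T x‖`, this scaling reduces the claim to `2 * r * (s - r) ≤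
      -- s ^ 2 - r ^ 2`, that is `0 ≤ (s - r) ^ 2`.
      refine ⟨1, fun _ => (2 * ‖T x‖) • x, fun ξ => ?_⟩
      have h1 : ((C ^ 2) • (J x * J x) - (‖T x‖ ^ 2) • (1 : E)) ξ
          = C ^ 2 * (η ξ x * η ξ x) - ‖T x‖ ^ 2 * 1 := rfl
      rw [h1, hη]
      simp only [map_smul, smul_eq_mul, abs_mul, norm_smul, Real.norm_eq_abs, Finset.univ_unique,
        Finset.sum_const, Finset.card_singleton, one_smul, abs_norm, abs_two]
      rw [← abs_mul_abs_self (ξ.1 x)]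
      nlinarith [sq_nonneg (C * |ξ.1 x| - ‖T x‖)]
    have := hΛ _ hmem
    rw [map_sub, map_smul, map_smul, hΛ1, smul_eq_mul, smul_eq_mul, mul_one, ← hb] at this
    linarith

/-! ### Grothendieck's inequality by truncation -/

/-- Rademacher sums on a finite probability space, with their second and fourth moments. -/
theorem exists_rademacher (N : ℕ) :
    ∃ (Ω : Type) (_ : Fintype Ω) (p : Ω → ℝ) (X : (Fin N → ℝ) → Ω → ℝ),
      (∀ ω, 0 ≤ p ω) ∧ ∑ ω, p ω = 1 ∧
      (∀ u v, ∑ ω, p ω * (X u ω * X v ω) = ∑ k, u k * v k) ∧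
      ∀ u, ∑ ω, p ω * X u ω ^ 4 ≤ 3 * (∑ k, u k ^ 2) ^ 2 := by
  induction N with
  | zero => exact ⟨Unit, inferInstance, fun _ => 1, fun _ _ => 0, by simp, by simp, by simp, by simp⟩
  | succ N ih =>
    obtain ⟨Ω, _, p, X, hp0, hp1, h2, h4⟩ := ih
    refine ⟨Ω × Bool, inferInstance, fun ω => p ω.1 / 2,
      fun u ω => X (fun k => u k.castSucc) ω.1 + (if ω.2 then 1 else -1) * u (Fin.last N),
      fun ω => by have := hp0 ω.1; positivity, ?_, fun u v => ?_, fun u => ?_⟩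
    · rw [Fintype.sum_prod_type, ← hp1]
      refine Finset.sum_congr rfl fun ω _ => ?_
      simp only [Fintype.sum_bool]
      ring
    · rw [Fintype.sum_prod_type, Fin.sum_univ_castSucc, ← h2,
        show u (Fin.last N) * v (Fin.last N) = (∑ ω, p ω) * (u (Fin.last N) * v (Fin.last N)) by
          rw [hp1, one_mul],
        Finset.sum_mul, ← Finset.sum_add_distrib]
      refine Finset.sum_congr rfl fun ω _ => ?_
      simp only [Fintype.sum_bool, if_true, Bool.false_eq_true, if_false]
      ring
    · set u' : Fin N → ℝ := fun k => u k.castSucc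
      set c := u (Fin.last N)
      -- Averaging over the new sign kills the odd powers of `c`; the factor `3` in the bound
      -- matches the coefficient `6`.
      have hexp : ∑ ω : Ω × Bool,
          p ω.1 / 2 * (X u' ω.1 + (if ω.2 then 1 else -1) * c) ^ 4
          = ∑ ω, p ω * X u' ω ^ 4 + (∑ ω, p ω * (X u' ω * X u' ω)) * (6 * c ^ 2)
            + (∑ ω, p ω) * c ^ 4 := by
        rw [Fintype.sum_prod_type, Finset.sum_mul, Finset.sum_mul, ← Finset.sum_add_distrib,
          ← Finset.sum_add_distrib]
        refine Finset.sum_congr rfl fun ω _ => ?_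
        simp only [Fintype.sum_bool, if_true, Bool.false_eq_true, if_false]
        ring
      have h2' : ∑ ω, p ω * (X u' ω * X u' ω) = ∑ k, u' k ^ 2 := by
        rw [h2]; exact Finset.sum_congr rfl fun k _ => (sq _).symm
      rw [hexp, h2', hp1, Fin.sum_univ_castSucc]
      have := h4 u'
      change _ ≤ 3 * (∑ k, u' k ^ 2 + c ^ 2) ^ 2
      nlinarith [sq_nonneg (c ^ 2)]

theorem abs_clamp_le (x : ℝ) : |max (-2) (min x 2)| ≤ 2 := by
  rw [abs_le]
  exact ⟨le_max_left _ _, max_le (by norm_num) (min_le_right _ _)⟩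

theorem sq_clamp_le (x : ℝ) : max (-2) (min x 2) ^ 2 ≤ x ^ 2 := by
  rcases le_total x 2 with h | h
  · rw [min_eq_left h]
    rcases le_total (-2) x with h' | h'
    · rw [max_eq_right h']
    · rw [max_eq_left h']; nlinarith
  · rw [min_eq_right h]; norm_num; nlinarith

/-- Beyond the clamp, `y - 2 ≤ y ^ 2 / 8` is `(y - 4) ^ 2 ≥ 0`. Fourth moments thereby make the
truncation error small in second moment. -/
theorem sq_sub_clamp_le (x : ℝ) : (x - max (-2) (min x 2)) ^ 2 ≤ x ^ 4 / 64 := by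
  have key : ∀ y : ℝ, 2 ≤ y → (y - 2) ^ 2 ≤ y ^ 4 / 64 := fun y hy => by
    have h1 : y - 2 ≤ y ^ 2 / 8 := by nlinarith [sq_nonneg (y - 4)]
    calc (y - 2) ^ 2 ≤ (y ^ 2 / 8) ^ 2 := by gcongr
      _ = _ := by ring
  rcases le_total x 2 with h | h
  · rw [min_eq_left h]
    rcases le_total (-2) x with h' | h'
    · rw [max_eq_right h', sub_self, zero_pow two_ne_zero]; positivity
    · rw [max_eq_left h']
      have := key (-x) (by linarith)
      calc (x - -2) ^ 2 = (-x - 2) ^ 2 := by ring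
        _ ≤ (-x) ^ 4 / 64 := this
        _ = _ := by ring
  · rw [min_eq_right h, max_eq_right (by norm_num)]
    exact key x h

section Grothendieck

variable {m n : Type*} [Fintype m] [Fintype n]

/-- The values of the matrix `a` on finite dimensional Euclidean vectors in the unit ball. -/
def euclideanValues (a : m → n → ℝ) : Set ℝ :=
  {r | ∃ (N : ℕ) (u : m → Fin N → ℝ) (v : n → Fin N → ℝ), (∀ i, ∑ k, u i k ^ 2 ≤ 1) ∧
    (∀ j, ∑ k, v j k ^ 2 ≤ 1) ∧ r = ∑ i, ∑ j, a i j * ∑ k, u i k * v j k}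

theorem mem_euclideanValues (a : m → n → ℝ) {Ω : Type*} [Fintype Ω] {u : m → Ω → ℝ}
    {v : n → Ω → ℝ} (hu : ∀ i, ∑ k, u i k ^ 2 ≤ 1) (hv : ∀ j, ∑ k, v j k ^ 2 ≤ 1) :
    ∑ i, ∑ j, a i j * ∑ k, u i k * v j k ∈ euclideanValues a := by
  let e := (Fintype.equivFin Ω).symm
  refine ⟨Fintype.card Ω, fun i k => u i (e k), fun j k => v j (e k), fun i => ?_, fun j => ?_, ?_⟩
  · rw [e.sum_comp fun k => u i k ^ 2]; exact hu i
  · rw [e.sum_comp fun k => v j k ^ 2]; exact hv j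
  · refine Finset.sum_congr rfl fun i _ => Finset.sum_congr rfl fun j _ => ?_
    rw [e.sum_comp fun k => u i k * v j k]

/-- By Cauchy–Schwarz each pairing is at most `1` in absolute value. Finiteness of the supremum is
what lets it be absorbed into itself later. -/
theorem bddAbove_euclideanValues (a : m → n → ℝ) : BddAbove (euclideanValues a) := by
  refine ⟨∑ i, ∑ j, |a i j|, ?_⟩
  rintro _ ⟨N, u, v, hu, hv, rfl⟩
  refine Finset.sum_le_sum fun i _ => Finset.sum_le_sum fun j _ => ?_
  refine (le_abs_self _).trans ?_
  rw [abs_mul]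
  refine mul_le_of_le_one_right (abs_nonneg _) ?_
  rw [← sq_le_one_iff_abs_le_one]
  refine (Finset.sum_mul_sq_le_sq_mul_sq _ _ _).trans (mul_le_one₀ (hu i) ?_ (hv j))
  positivity

/-- With weights in place of the counting measure. -/
theorem weighted_le_sSup_euclideanValues (a : m → n → ℝ) {Ω : Type*} [Fintype Ω] {p : Ω → ℝ}
    (hp : ∀ ω, 0 ≤ p ω) {u : m → Ω → ℝ} {v : n → Ω → ℝ}
    (hu : ∀ i, ∑ ω, p ω * u i ω ^ 2 ≤ 1) (hv : ∀ j, ∑ ω, p ω * v j ω ^ 2 ≤ 1) :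
    ∑ i, ∑ j, a i j * ∑ ω, p ω * (u i ω * v j ω) ≤ sSup (euclideanValues a) := by
  have hs : ∀ ω, √(p ω) * √(p ω) = p ω := fun ω => Real.mul_self_sqrt (hp ω)
  have := mem_euclideanValues a (u := fun i ω => √(p ω) * u i ω)
    (v := fun j ω => √(p ω) * v j ω)
    (fun i => by simpa only [mul_pow, Real.sq_sqrt (hp _)] using hu i)
    (fun j => by simpa only [mul_pow, Real.sq_sqrt (hp _)] using hv j)
  have hm : ∀ i j ω, √(p ω) * u i ω * (√(p ω) * v j ω) = p ω * (u i ω * v j ω) := fun i j ω => by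
    rw [mul_mul_mul_comm, hs]
  simp only [hm] at this
  exact le_csSup (bddAbove_euclideanValues a) this

/-- **Grothendieck's inequality** for Euclidean vectors. -/
theorem euclideanValues_le {a : m → n → ℝ} {W : ℝ}
    (ha : ∀ (s : m → ℝ) (t : n → ℝ), (∀ i, |s i| ≤ 1) → (∀ j, |t j| ≤ 1) →
      ∑ i, ∑ j, a i j * (s i * t j) ≤ W) :
    ∀ r ∈ euclideanValues a, r ≤ 8 * W := by
  set S := sSup (euclideanValues a) with hS
  have hne : (euclideanValues a).Nonempty :=
    ⟨_, mem_euclideanValues a (Ω := Fin 0) (u := fun _ _ => 0) (v := fun _ _ => 0)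
      (by simp) (by simp)⟩
  suffices h : ∀ r ∈ euclideanValues a, r ≤ 4 * W + S / 2 by
    have h1 : S ≤ 4 * W + S / 2 := csSup_le hne h
    intro r hr
    linarith [h r hr]
  rintro _ ⟨N, u, v, hu, hv, rfl⟩
  obtain ⟨Ω, _, p, X, hp0, hp1, h2, h4⟩ := exists_rademacher N
  let c : ℝ → ℝ := fun x => max (-2) (min x 2)
  have hX2 : ∀ w : Fin N → ℝ, ∑ k, w k ^ 2 ≤ 1 → ∑ ω, p ω * X w ω ^ 2 ≤ 1 := fun w hw => by
    refine le_trans (le_of_eq ?_) hw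
    simp only [sq, h2]
  have hc2 : ∀ w : Fin N → ℝ, ∑ k, w k ^ 2 ≤ 1 → ∑ ω, p ω * c (X w ω) ^ 2 ≤ 1 := fun w hw =>
    (Finset.sum_le_sum fun ω _ => mul_le_mul_of_nonneg_left (sq_clamp_le _) (hp0 ω)).trans
      (hX2 w hw)
  -- The remainder has second moment at most `3 / 64`, so four times it still lies in the unit ball.
  have hr2 : ∀ w : Fin N → ℝ, ∑ k, w k ^ 2 ≤ 1 →
      ∑ ω, p ω * (4 * (X w ω - c (X w ω))) ^ 2 ≤ 1 := fun w hw => by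
    have h0 : 0 ≤ ∑ k, w k ^ 2 := by positivity
    have h5 : ∑ ω, p ω * X w ω ^ 4 ≤ 3 := (h4 w).trans (by nlinarith)
    calc ∑ ω, p ω * (4 * (X w ω - c (X w ω))) ^ 2
        ≤ ∑ ω, p ω * X w ω ^ 4 * (1 / 4) := Finset.sum_le_sum fun ω _ => by
          rw [mul_assoc]
          refine mul_le_mul_of_nonneg_left ?_ (hp0 ω)
          have := sq_sub_clamp_le (X w ω)
          rw [mul_pow]
          change (X w ω - c (X w ω)) ^ 2 ≤ _ at this
          linarith
      _ ≤ 1 := by rw [← Finset.sum_mul]; linarith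
  have e1 : ∑ i, ∑ j, a i j * ∑ ω, p ω * (c (X (u i) ω) * c (X (v j) ω)) ≤ 4 * W := by
    have hω : ∀ ω, ∑ i, ∑ j, a i j * (c (X (u i) ω) * c (X (v j) ω)) ≤ 4 * W := fun ω => by
      have hhalf : ∀ x, |c x / 2| ≤ 1 := fun x => by
        rw [abs_div, abs_two, div_le_one two_pos]; exact abs_clamp_le x
      have := ha (fun i => c (X (u i) ω) / 2) (fun j => c (X (v j) ω) / 2)
        (fun i => hhalf _) (fun j => hhalf _)
      refine le_trans (le_of_eq ?_) (mul_le_mul_of_nonneg_left this (by norm_num : (0 : ℝ) ≤ 4))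
      rw [Finset.mul_sum]
      refine Finset.sum_congr rfl fun i _ => ?_
      rw [Finset.mul_sum]
      exact Finset.sum_congr rfl fun j _ => by ring
    calc ∑ i, ∑ j, a i j * ∑ ω, p ω * (c (X (u i) ω) * c (X (v j) ω))
        = ∑ ω, p ω * ∑ i, ∑ j, a i j * (c (X (u i) ω) * c (X (v j) ω)) := by
          simp only [Finset.mul_sum]
          rw [Finset.sum_comm (γ := Ω)]
          refine Finset.sum_congr rfl fun i _ => ?_
          rw [Finset.sum_comm (γ := Ω)]
          exact Finset.sum_congr rfl fun j _ => Finset.sum_congr rfl fun ω _ => by ring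
      _ ≤ ∑ ω, p ω * (4 * W) :=
          Finset.sum_le_sum fun ω _ => mul_le_mul_of_nonneg_left (hω ω) (hp0 ω)
      _ = 4 * W := by rw [← Finset.sum_mul, hp1, one_mul]
  have e2 := weighted_le_sSup_euclideanValues a hp0 (fun i => hr2 _ (hu i)) (fun j => hc2 _ (hv j))
  have e3 := weighted_le_sSup_euclideanValues a hp0 (fun i => hX2 _ (hu i)) (fun j => hr2 _ (hv j))
  rw [← hS] at e2 e3
  -- This is `x * y = c x * c y + (x - c x) * c y + x * (y - c y)`. The first term costs `4 * W` as
  -- both clamps are at `2`; the others cost `S / 4` each.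
  have hsplit : ∑ i, ∑ j, a i j * ∑ k, u i k * v j k
      = ∑ i, ∑ j, a i j * ∑ ω, p ω * (c (X (u i) ω) * c (X (v j) ω))
        + (∑ i, ∑ j, a i j * ∑ ω, p ω * (4 * (X (u i) ω - c (X (u i) ω)) * c (X (v j) ω))) * (1 / 4)
        + (∑ i, ∑ j, a i j * ∑ ω, p ω * (X (u i) ω * (4 * (X (v j) ω - c (X (v j) ω))))) * (1 / 4) := by
    simp only [Finset.sum_mul, ← Finset.sum_add_distrib]
    refine Finset.sum_congr rfl fun i _ => Finset.sum_congr rfl fun j _ => ?_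
    rw [← h2]
    simp only [Finset.mul_sum, Finset.sum_mul, ← Finset.sum_add_distrib]
    exact Finset.sum_congr rfl fun ω _ => by ring
  rw [hsplit]
  linarith

/-- **Grothendieck's inequality**. -/
theorem grothendieck_inequality {a : m → n → ℝ} {W : ℝ}
    (ha : ∀ (s : m → ℝ) (t : n → ℝ), (∀ i, |s i| ≤ 1) → (∀ j, |t j| ≤ 1) →
      ∑ i, ∑ j, a i j * (s i * t j) ≤ W)
    {H : Type*} [NormedAddCommGroup H] [InnerProductSpace ℝ H] {u : m → H} {v : n → H}
    (hu : ∀ i, ‖u i‖ ≤ 1) (hv : ∀ j, ‖v j‖ ≤ 1) :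
    ∑ i, ∑ j, a i j * inner ℝ (u i) (v j) ≤ 8 * W := by
  let V : Submodule ℝ H := Submodule.span ℝ (Set.range u ∪ Set.range v)
  have : FiniteDimensional ℝ V :=
    FiniteDimensional.span_of_finite ℝ ((Set.finite_range u).union (Set.finite_range v))
  have hu' : ∀ i, u i ∈ V := fun i => Submodule.subset_span (Or.inl ⟨i, rfl⟩)
  have hv' : ∀ j, v j ∈ V := fun j => Submodule.subset_span (Or.inr ⟨j, rfl⟩)
  let b := stdOrthonormalBasis ℝ V
  have hb : ∀ x : V, ∑ k, b.repr x k ^ 2 = ‖(x : H)‖ ^ 2 := fun x => by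
    rw [← Submodule.coe_norm, ← b.repr.norm_map x, EuclideanSpace.real_norm_sq_eq]
  have hb' : ∀ x y : V, ∑ k, b.repr x k * b.repr y k = inner ℝ (x : H) y := fun x y => by
    rw [← Submodule.coe_inner, ← b.repr.inner_map_map x y, PiLp.inner_apply]
    exact Finset.sum_congr rfl fun k _ => mul_comm _ _
  have := euclideanValues_le ha _ (mem_euclideanValues a
    (u := fun i => b.repr ⟨u i, hu' i⟩) (v := fun j => b.repr ⟨v j, hv' j⟩)
    (fun i => by rw [hb]; exact pow_le_one₀ (norm_nonneg _) (hu i))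
    (fun j => by rw [hb]; exact pow_le_one₀ (norm_nonneg _) (hv j)))
  simpa only [hb'] using this

end Grothendieck

/-! ### Grothendieck's theorem -/

/-- The `t j` are the coordinates of a functional of norm at most `1` on `ℓ₁`, and the `s i` are
absorbed by absolute values. This is the scalar hypothesis of Grothendieck's inequality for the
coordinate matrix. -/
theorem sum_mul_le_weakSum {K : Submodule ℝ EllOne} {n N : ℕ} (x : Fin n → K) {s : Fin n → ℝ}
    {t : Fin N → ℝ} (hs : ∀ i, |s i| ≤ 1) (ht : ∀ j, |t j| ≤ 1) :
    ∑ i, ∑ j : Fin N, (x i : EllOne) j * (s i * t j) ≤ weakSum x := by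
  let ξ : StrongDual ℝ EllOne := ∑ j : Fin N, t j • lp.evalCLM ℝ (fun _ : ℕ => ℝ) 1 (j : ℕ)
  have hξ : ∀ z : EllOne, ξ z = ∑ j : Fin N, t j * z j := fun z => by
    simp only [ξ, sum_apply]
    rfl
  have hle : ∀ z : EllOne, |ξ z| ≤ ‖z‖ := fun z => by
    rw [hξ]
    refine (Finset.abs_sum_le_sum_abs _ _).trans ?_
    calc ∑ j : Fin N, |t j * z j| ≤ ∑ j : Fin N, ‖z j‖ := Finset.sum_le_sum fun j _ => by
          rw [abs_mul]; exact mul_le_of_le_one_left (abs_nonneg _) (ht j)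
      _ = ∑ j ∈ Finset.range N, ‖z j‖ := Fin.sum_univ_eq_sum_range (fun j => ‖z j‖) N
      _ ≤ ‖z‖ := sum_le_hasSum _ (fun _ _ => norm_nonneg _) (hasSum_norm_ellOne z)
  let η : StrongDual ℝ K := ξ.comp K.subtypeL
  have hη : dist η 0 ≤ 1 := by
    refine (dist_zero_right η).trans_le ?_
    exact η.opNorm_le_bound zero_le_one fun z => by rw [one_mul]; exact hle z
  refine le_trans ?_ (le_ciSup (bddAbove_weakSum x) ⟨η, hη⟩)
  refine Finset.sum_le_sum fun i _ => ?_
  calc ∑ j : Fin N, (x i : EllOne) j * (s i * t j) = s i * ξ (x i) := by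
        rw [hξ, Finset.mul_sum]
        exact Finset.sum_congr rfl fun j _ => by ring
    _ ≤ |s i * ξ (x i)| := le_abs_self _
    _ ≤ |ξ (x i)| := by
        rw [abs_mul]; exact mul_le_of_le_one_left (abs_nonneg _) (hs i)

/-- **Grothendieck's theorem**: an operator from `ℓ₁` to a Hilbert space is `1`-summing, and so are
its restrictions to subspaces. -/
theorem isOneSumming_restrict {H : Type*} [NormedAddCommGroup H] [InnerProductSpace ℝ H]
    (S : EllOne →L[ℝ] H) {K : Submodule ℝ EllOne} {T : K →L[ℝ] H} (hST : ∀ x : K, S x = T x) :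
    IsOneSumming T := by
  -- Adding `1` allows division even when `S = 0`.
  have hc : 0 < ‖S‖ + 1 := by positivity
  refine ⟨8 * (‖S‖ + 1), fun n x => ?_⟩
  simp only [← hST]
  -- Truncating to `N` coordinates leaves a finite matrix, with a bound independent of `N`.
  have hlim : Filter.Tendsto (fun N => ∑ i, ‖S (∑ j ∈ Finset.range N,
      (x i : EllOne) j • lp.single 1 j (1 : ℝ))‖) Filter.atTop (nhds (∑ i, ‖S (x i)‖)) :=
    tendsto_finsetSum _ fun i _ => ((S.continuous.tendsto _).comp
      (hasSum_single_ellOne (x i)).tendsto_sum_nat).norm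
  refine le_of_tendsto' hlim fun N => ?_
  set y : Fin n → H := fun i => S (∑ j ∈ Finset.range N, (x i : EllOne) j • lp.single 1 j (1 : ℝ))
    with hy
  have hv : ∀ j : Fin N, ‖(‖S‖ + 1)⁻¹ • S (lp.single 1 (j : ℕ) (1 : ℝ))‖ ≤ 1 := fun j => by
    have h1 := S.le_opNorm (lp.single 1 (j : ℕ) (1 : ℝ))
    rw [lp.norm_single (by simp), norm_one, mul_one] at h1
    rw [norm_smul, norm_inv, Real.norm_of_nonneg hc.le, inv_mul_le_one₀ hc]
    linarith
  have hu : ∀ i, ‖‖y i‖⁻¹ • y i‖ ≤ 1 := fun i => by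
    rw [norm_smul, norm_inv, norm_norm]
    exact inv_mul_le_one
  have hG := grothendieck_inequality (a := fun i (j : Fin N) => (x i : EllOne) j)
    (fun s t hs ht => sum_mul_le_weakSum x hs ht) hu hv
  -- Pairing `y i` with its own direction turns its norm into a row sum of the Grothendieck form; if
  -- `y i = 0`, then `0⁻¹ = 0` makes both sides vanish.
  have hyi : ∀ i, ‖y i‖ = (‖S‖ + 1) * ∑ j : Fin N, (x i : EllOne) j *
      inner ℝ (‖y i‖⁻¹ • y i) ((‖S‖ + 1)⁻¹ • S (lp.single 1 (j : ℕ) (1 : ℝ))) := fun i => by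
    have hexp : y i = ∑ j : Fin N, (x i : EllOne) j • S (lp.single 1 (j : ℕ) (1 : ℝ)) := by
      rw [Fin.sum_univ_eq_sum_range
        (fun j => (x i : EllOne) j • S (lp.single 1 (j : ℕ) (1 : ℝ))) N]
      simp [hy, map_sum]
    have hn : ‖y i‖ = inner ℝ (‖y i‖⁻¹ • y i) (y i) := by
      rw [real_inner_smul_left, real_inner_self_eq_norm_sq]
      rcases eq_or_ne ‖y i‖ 0 with h | h
      · simp [h]
      · field_simp
    conv_lhs => rw [hn]; arg 3; rw [hexp]
    rw [inner_sum, Finset.mul_sum]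
    refine Finset.sum_congr rfl fun j _ => ?_
    rw [real_inner_smul_right, real_inner_smul_right]
    field_simp
  rw [Finset.sum_congr rfl fun i _ => hyi i, ← Finset.mul_sum]
  calc _ ≤ (‖S‖ + 1) * (8 * weakSum x) := mul_le_mul_of_nonneg_left hG hc.le
    _ = _ := by ring

/-- An operator on a subspace of a separable space that is dominated by a quadratic form extends to
the whole space. -/
theorem IsNonnegQuadForm.exists_extension {X : Type*} [NormedAddCommGroup X] [NormedSpace ℝ X]
    [TopologicalSpace.SeparableSpace X] {Y : Type*} [NormedAddCommGroup Y] [NormedSpace ℝ Y]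
    [CompleteSpace Y] {Q : X → ℝ} (hQ : IsNonnegQuadForm Q) {K : Submodule ℝ X} (T : K →L[ℝ] Y)
    (h : ∀ x : K, ‖T x‖ ^ 2 ≤ Q x) : ∃ S : X →L[ℝ] Y, ∀ x : K, S x = T x := by
  obtain ⟨A, hA⟩ := hQ.exists_operator
  refine exists_extension_of_norm_le T A fun x => le_of_sq_le_sq ?_ (norm_nonneg _)
  rw [← hA]
  exact h x

end GTSpace

/-! ### The cycle of implications -/

theorem theorem3p2 (Z : Type u) [NormedAddCommGroup Z] [NormedSpace ℝ Z] [CompleteSpace Z]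
    [TopologicalSpace.SeparableSpace Z]
    (φ : GTSpace.EllOne →L[ℝ] Z) (hφ : Function.Surjective φ) :
    List.TFAE [
      GTSpace.EveryTwistedSumSplits.{u, v} Z,
      GTSpace.IsGTSpace φ.ker,
      ∀ q : φ.ker → ℝ, GTSpace.IsNonnegQuadForm q →
        ∃ Q : GTSpace.EllOne → ℝ, GTSpace.IsNonnegQuadForm Q ∧ ∀ x : φ.ker, Q x = q x,
      ∀ q : φ.ker → ℝ, GTSpace.IsNonnegQuadForm q →
        ∃ Q : GTSpace.EllOne → ℝ, GTSpace.IsDeltaSemidefinite Q ∧ ∀ x : φ.ker, Q x = q x] := by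
  tfae_have 1 → 2 := fun h T => by
    obtain ⟨S, hS⟩ := h.extension hφ T
    exact GTSpace.isOneSumming_restrict S hS
  tfae_have 2 → 3 := fun h q hq => by
    obtain ⟨T, hT⟩ := hq.exists_operator
    obtain ⟨Q, hQ, hTQ⟩ := (h T).exists_quadForm_domination
    obtain ⟨S, hS⟩ := hQ.exists_extension T hTQ
    exact ⟨_, GTSpace.isNonnegQuadForm_norm_sq S, fun x => by rw [hS, hT]⟩
  tfae_have 3 → 4 := fun h q hq => by
    obtain ⟨Q, hQ, hQq⟩ := h q hq
    exact ⟨Q, ⟨Q, fun _ => 0, hQ, ⟨⟨0, fun _ => rfl⟩, fun _ => le_rfl⟩, fun x => (sub_zero _).symm⟩,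
      hQq⟩
  tfae_have 4 → 1 := fun h => GTSpace.everyTwistedSumSplits_of_extension hφ fun T => by
    obtain ⟨Q, ⟨q₁, q₂, h₁, h₂, hQ⟩, hQT⟩ := h _ (GTSpace.isNonnegQuadForm_norm_sq T)
    refine h₁.exists_extension T fun x => ?_
    rw [← hQT x, hQ]
    exact sub_le_self _ (h₂.2 _)
  tfae_finish
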